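/- **Definitions.** A theory is an arbitrary set of sentences (not necessarily recursively enumerable), either of the language $\mathcal L_2$ of second-order arithmetic or of the language $\mathcal L_\in=\{\in\}$ of set theory; $T$ extends $T_0$ if every sentence of $T_0$ is a consequence of $T$. * An $\mathcal L_2$ $\beta$-model is an $\omega$-model $M\subseteq\mathcal P(\mathbb N)$ such that every $\Sigma^1_1$ formula with parameters from $M$ holds in $M$ if and only if it holds in $\mathcal P(\mathbb N)$. For $\beta$-models $N,M$ of this kind, $N\in M$ means that some $C\in M$ codes $N$, i.e. $N=\{(C)_n : n\in\mathbb N\}$, where $(C)_n=\{k : \langle k,n\rangle\in C\}$. * $\mathsf{PRS}$ is the set of all consequences in the language $\{\in\}$ of primitive recursive set theory (extensionality, foundation, infinity, and the defining axiom of each primitive recursive set function), and $\mathsf{Beta}$ is the axiom that every regular relation has a collapsing function. An $\mathcal L_\in$ $\beta$-model is a well-founded $\mathcal L_\in$-structure satisfying $\mathsf{PRS}$. For an $\mathcal L_\in$ $\beta$-model $M$, $N\in M$ means that $N$ is the structure $\bigl(\{x\in M : M\models x\in A\},\ \{(x,y) : M\models\langle x,y\rangle\in E\}\bigr)$ given by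 an element $\langle A,E\rangle$ of $M$ with $M\models E\subseteq A\times A$. * Let $T_0$ be an $\mathcal L_2$-theory extending $\mathsf{ATR}_0$ or an $\mathcal L_\in$-theory extending $\mathsf{PRS}+\mathsf{Beta}$. For theories $S,T$ (in the same language) extending $T_0$, put $S<^{T_0}_\beta T$ if for every $\beta$-model $M$ of $T$ there is a $\beta$-model $N\in M$ with $N\models S$. If $T$ lies in the well-founded part of $<^{T_0}_\beta$, then its rank is the ordinal $|T|_\beta=\sup\{|S|_\beta+1 : S<^{T_0}_\beta T\}$. **Theorem.** Let $T_0$ be an $\mathcal L_2$-theory extending $\mathsf{ATR}_0$, or an $\mathcal L_\in$-theory extending $\mathsf{PRS}+\mathsf{Beta}$. Then every theory $T$ that extends $T_0$ and has a $\beta$-model lies in the well-founded part of $<^{T_0}_\beta$, and $|T|_\beta<\omega_1$. -/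

import Mathlib

open FirstOrder FirstOrder.Language
open scoped Ordinal

universe u

namespace BetaRank

/-! ## Second-order arithmetic

Variables are de Bruijn levels: in a context with `n` number variables, the available
number variables are `0, …, n - 1`, and a number quantifier binds the variable `n`; the set
variables are treated in the same way. -/

/-- Number terms with number variables `0, …, n - 1`. -/
inductive L2Term (n : ℕ) : Type
  | var (i : Fin n) : L2Term n
  | zero : L2Term n
  | one : L2Term n
  | add (s t : L2Term n) : L2Term n
  | mul (s t : L2Term n) : L2Term n

/-- Formulas of two-sorted second-order arithmetic with number variables `0, …, n - 1` and set
variables `0, …, m - 1`. -/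
inductive L2Formula : ℕ → ℕ → Type
  | eq {n m : ℕ} (s t : L2Term n) : L2Formula n m
  | lt {n m : ℕ} (s t : L2Term n) : L2Formula n m
  | mem {n m : ℕ} (t : L2Term n) (X : Fin m) : L2Formula n m
  | falsum {n m : ℕ} : L2Formula n m
  | imp {n m : ℕ} (φ ψ : L2Formula n m) : L2Formula n m
  | allNum {n m : ℕ} (φ : L2Formula (n + 1) m) : L2Formula n m
  | allSet {n m : ℕ} (φ : L2Formula n (m + 1)) : L2Formula n m

abbrev L2Sentence : Type := L2Formula 0 0

/-- Arbitrary sets of sentences (not necessarily recursively enumerable). -/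
abbrev L2Theory : Type := Set L2Sentence

namespace L2Formula

def neg {n m : ℕ} (φ : L2Formula n m) : L2Formula n m := φ.imp falsum
def and {n m : ℕ} (φ ψ : L2Formula n m) : L2Formula n m := (φ.imp ψ.neg).neg
def or {n m : ℕ} (φ ψ : L2Formula n m) : L2Formula n m := φ.neg.imp ψ
def iff {n m : ℕ} (φ ψ : L2Formula n m) : L2Formula n m := (φ.imp ψ).and (ψ.imp φ)
def exNum {n m : ℕ} (φ : L2Formula (n + 1) m) : L2Formula n m := φ.neg.allNum.neg
def exSet {n m : ℕ} (φ : L2Formula n (m + 1)) : L2Formula n m := φ.neg.allSet.neg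

/-- Universal closure with respect to the number variables. -/
def allNums {m : ℕ} : {n : ℕ} → L2Formula n m → L2Formula 0 m
  | 0, φ => φ
  | _ + 1, φ => φ.allNum.allNums

/-- Universal closure with respect to the set variables. -/
def allSets {n : ℕ} : {m : ℕ} → L2Formula n m → L2Formula n 0
  | 0, φ => φ
  | _ + 1, φ => φ.allSet.allSets

/-- A formula is arithmetical if it has no set quantifiers (set parameters are allowed). -/
def Arithmetical : {n m : ℕ} → L2Formula n m → Prop
  | _, _, eq _ _ => True
  | _, _, lt _ _ => True
  | _, _, mem _ _ => True
  | _, _, falsum => True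
  | _, _, imp φ ψ => φ.Arithmetical ∧ ψ.Arithmetical
  | _, _, allNum φ => φ.Arithmetical
  | _, _, allSet _ => False

end L2Formula

/-- Renaming of variables. -/
def L2Term.rename {n n' : ℕ} (f : Fin n → Fin n') : L2Term n → L2Term n'
  | .var i => .var (f i)
  | .zero => .zero
  | .one => .one
  | .add s t => .add (s.rename f) (t.rename f)
  | .mul s t => .mul (s.rename f) (t.rename f)

/-- Renaming of free variables, the bound variables being shifted accordingly. -/
def L2Formula.rename : {n m n' m' : ℕ} → L2Formula n m → (Fin n → Fin n') → (Fin m → Fin m') →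
    L2Formula n' m'
  | _, _, _, _, .eq s t, f, _ => .eq (s.rename f) (t.rename f)
  | _, _, _, _, .lt s t, f, _ => .lt (s.rename f) (t.rename f)
  | _, _, _, _, .mem t X, f, g => .mem (t.rename f) (g X)
  | _, _, _, _, .falsum, _, _ => .falsum
  | _, _, _, _, .imp φ ψ, f, g => .imp (φ.rename f g) (ψ.rename f g)
  | _, _, n', _, .allNum φ, f, g =>
      .allNum (φ.rename (Fin.snoc (fun i => (f i).castSucc) (Fin.last n')) g)
  | _, _, _, m', .allSet φ, f, g =>
      .allSet (φ.rename f (Fin.snoc (fun i => (g i).castSucc) (Fin.last m')))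

/-- Structures for the language of second-order arithmetic: the set variables range over a family
of subsets of the domain of the number variables. -/
structure L2Structure where
  Num : Type u
  Sets : Set (Set Num)
  zero : Num
  one : Num
  add : Num → Num → Num
  mul : Num → Num → Num
  lt : Num → Num → Prop

def L2Term.eval (M : L2Structure.{u}) {n : ℕ} (v : Fin n → M.Num) : L2Term n → M.Num
  | .var i => v i
  | .zero => M.zero
  | .one => M.one
  | .add s t => M.add (s.eval M v) (t.eval M v)
  | .mul s t => M.mul (s.eval M v) (t.eval M v)

/-- Satisfaction of a formula in `M` under an assignment of numbers and sets of `M`. -/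
def L2Formula.Sat (M : L2Structure.{u}) : {n m : ℕ} → L2Formula n m → (Fin n → M.Num) →
    (Fin m → M.Sets) → Prop
  | _, _, .eq s t, v, _ => s.eval M v = t.eval M v
  | _, _, .lt s t, v, _ => M.lt (s.eval M v) (t.eval M v)
  | _, _, .mem t X, v, W => t.eval M v ∈ (W X : Set M.Num)
  | _, _, .falsum, _, _ => False
  | _, _, .imp φ ψ, v, W => φ.Sat M v W → ψ.Sat M v W
  | _, _, .allNum φ, v, W => ∀ a : M.Num, φ.Sat M (Fin.snoc v a) W
  | _, _, .allSet φ, v, W => ∀ A : M.Sets, φ.Sat M v (Fin.snoc W A)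

/-- `M` is a model of `T`. -/
def L2Structure.Models (M : L2Structure.{u}) (T : L2Theory) : Prop :=
  ∀ σ ∈ T, σ.Sat M Fin.elim0 Fin.elim0

/-- `T` extends `U`: every sentence of `U` is a logical consequence of `T`. (Both sorts of a
structure are nonempty, as usual in first-order logic.) -/
def L2Theory.Extends (T U : L2Theory) : Prop :=
  ∀ M : L2Structure.{0}, M.Sets.Nonempty → M.Models T → M.Models U

/-! ### The theory `ATR₀` -/

/-- The number variable of level `k`. -/
def nv {n : ℕ} (k : ℕ) (h : k < n := by omega) : L2Term n := .var ⟨k, h⟩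

/-- The set variable of level `k`. -/
def sv {m : ℕ} (k : ℕ) (h : k < m := by omega) : Fin m := ⟨k, h⟩

/-- The number coding the pair `(s, t)`, namely `(s + t)² + s`. -/
def L2Term.pair {n : ℕ} (s t : L2Term n) : L2Term n := ((s.add t).mul (s.add t)).add s

namespace L2Formula

/-- `s ≤_X t`, where `X` is regarded as a set of codes of pairs. -/
def leIn {n m : ℕ} (X : Fin m) (s t : L2Term n) : L2Formula n m := .mem (s.pair t) X

/-- `s <_X t`. -/
def ltIn {n m : ℕ} (X : Fin m) (s t : L2Term n) : L2Formula n m :=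
  (leIn X s t).and (leIn X t s).neg

/-- `t` belongs to the field of the reflexive relation `X`. -/
def inField {n m : ℕ} (X : Fin m) (t : L2Term n) : L2Formula n m := leIn X t t

/-- `X` is a (reflexive) linear ordering of its field. -/
def linearOrder (n : ℕ) {m : ℕ} (X : Fin m) : L2Formula n m :=
  (allNum (allNum ((leIn X (nv n) (nv (n + 1))).imp
    ((inField X (nv n)).and (inField X (nv (n + 1))))))).and
  ((allNum (allNum (allNum ((leIn X (nv n) (nv (n + 1))).imp
    ((leIn X (nv (n + 1)) (nv (n + 2))).imp (leIn X (nv n) (nv (n + 2)))))))).and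
  ((allNum (allNum ((leIn X (nv n) (nv (n + 1))).imp
    ((leIn X (nv (n + 1)) (nv n)).imp (.eq (nv n) (nv (n + 1))))))).and
  (allNum (allNum ((inField X (nv n)).imp ((inField X (nv (n + 1))).imp
    ((leIn X (nv n) (nv (n + 1))).or (leIn X (nv (n + 1)) (nv n)))))))))

/-- `X` is a well-ordering: a linear ordering such that every set `Z` that meets the field of `X`
has an `X`-least element in the field of `X`. -/
def wellOrder (n : ℕ) {m : ℕ} (X : Fin m) : L2Formula n m :=
  (linearOrder n X).and
  (allSet ((exNum ((mem (nv n) (sv m)).and (inField X.castSucc (nv n)))).imp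
    (exNum (((mem (nv n) (sv m)).and (inField X.castSucc (nv n))).and
      (allNum ((mem (nv (n + 1)) (sv m)).imp (ltIn X.castSucc (nv (n + 1)) (nv n)).neg))))))

/-- Comprehension for `φ(x)`, with `x` the last number variable; all other free variables of `φ`
are parameters: `∃ X ∀ x (x ∈ X ↔ φ(x))`. -/
def comprehension {n m : ℕ} (φ : L2Formula (n + 1) m) : L2Sentence :=
  (exSet (allNum ((mem (nv n) (sv m)).iff (φ.rename id Fin.castSucc)))).allNums.allSets

/-- Transfinite recursion for `θ(k, Z)`, with `k` the last number variable and `Z` the last set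
variable of `θ`; all other free variables of `θ` are parameters: for every well-ordering `X` there
is a set `Y` such that for all `p`,
`p ∈ Y` iff `p = (k, j)` for some `k` and some `j` in the field of `X` with `θ(k, Y^j)`, where
`Y^j = {q ∈ Y | q = (a, i) for some a and some i <_X j}`. -/
def transfiniteRecursion {n m : ℕ} (θ : L2Formula (n + 1) (m + 1)) : L2Sentence :=
  -- sets: `X` has level `m`, `Y` level `m + 1`, `Z` level `m + 2`
  -- numbers: `p` has level `n`, `k` level `n + 1`, `j` level `n + 2`, `q` level `n + 3`,
  -- `a` level `n + 4`, `i` level `n + 5`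
  (allSet ((wellOrder n (sv m)).imp (exSet (allNum ((mem (nv n) (sv (m + 1))).iff
    (exNum (exNum (((eq (nv n) ((nv (n + 1)).pair (nv (n + 2)))).and
      (inField (sv m) (nv (n + 2)))).and
      (exSet ((allNum ((mem (nv (n + 3)) (sv (m + 2))).iff ((mem (nv (n + 3)) (sv (m + 1))).and
          (exNum (exNum ((eq (nv (n + 3)) ((nv (n + 4)).pair (nv (n + 5)))).and
            (ltIn (sv m) (nv (n + 5)) (nv (n + 2))))))))).and
        (θ.rename (Fin.snoc (fun i : Fin n => i.castLE (by omega)) (⟨n + 1, by omega⟩ : Fin (n + 3)))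
          (Fin.snoc (fun i : Fin m => i.castLE (by omega))
            (⟨m + 2, by omega⟩ : Fin (m + 3)))))))))))))).allNums.allSets

end L2Formula

open L2Formula in
/-- The axioms of `ATR₀`: basic arithmetic, the induction axiom, arithmetical comprehension and
arithmetical transfinite recursion. -/
inductive ATR0Axiom : L2Sentence → Prop
  | succ_ne_zero : ATR0Axiom (allNum (eq ((nv 0).add .one) .zero).neg)
  | succ_inj : ATR0Axiom (allNum (allNum ((eq ((nv 0).add .one) ((nv 1).add .one)).imp
      (eq (nv 0) (nv 1)))))
  | add_zero : ATR0Axiom (allNum (eq ((nv 0).add .zero) (nv 0)))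
  | add_succ : ATR0Axiom (allNum (allNum (eq ((nv 0).add ((nv 1).add .one))
      (((nv 0).add (nv 1)).add .one))))
  | mul_zero : ATR0Axiom (allNum (eq ((nv 0).mul .zero) .zero))
  | mul_succ : ATR0Axiom (allNum (allNum (eq ((nv 0).mul ((nv 1).add .one))
      (((nv 0).mul (nv 1)).add (nv 0)))))
  | not_lt_zero : ATR0Axiom (allNum (lt (nv 0) .zero).neg)
  | lt_succ : ATR0Axiom (allNum (allNum ((lt (nv 0) ((nv 1).add .one)).iff
      ((lt (nv 0) (nv 1)).or (eq (nv 0) (nv 1))))))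
  | induction : ATR0Axiom (allSet (((mem .zero (sv 0)).and
      (allNum ((mem (nv 0) (sv 0)).imp (mem ((nv 0).add .one) (sv 0))))).imp
      (allNum (mem (nv 0) (sv 0)))))
  | comprehension {n m : ℕ} (φ : L2Formula (n + 1) m) (hφ : φ.Arithmetical) :
      ATR0Axiom (comprehension φ)
  | transfiniteRecursion {n m : ℕ} (θ : L2Formula (n + 1) (m + 1)) (hθ : θ.Arithmetical) :
      ATR0Axiom (transfiniteRecursion θ)

def ATR0 : L2Theory := {σ | ATR0Axiom σ}

/-! ### `β`-models of second-order arithmetic -/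

/-- The `ω`-model whose sets are the members of `S`. -/
def omegaModel (S : Set (Set ℕ)) : L2Structure.{0} where
  Num := ℕ
  Sets := S
  zero := 0
  one := 1
  add := (· + ·)
  mul := (· * ·)
  lt := (· < ·)

/-- The `ω`-model `S` is a `β`-model: for every `Σ¹₁` formula `∃ X θ`, with `θ` arithmetical, and
all parameters from `S`, the formula holds in `S` if and only if it holds in `𝒫(ℕ)`. -/
def IsL2BetaModel (S : Set (Set ℕ)) : Prop :=
  ∀ (n m : ℕ) (θ : L2Formula n (m + 1)), θ.Arithmetical → ∀ (v : Fin n → ℕ) (W : Fin m → S),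
    θ.exSet.Sat (omegaModel S) v W ↔
      θ.exSet.Sat (omegaModel Set.univ) v (fun i => ⟨(W i : Set ℕ), Set.mem_univ _⟩)

/-- The countable `ω`-model `{(C)ₙ | n ∈ ℕ}` coded by `C ⊆ ℕ`, where `(C)ₙ = {k | (k, n) ∈ C}` and
`(k, n) = (k + n)² + k`. -/
def decode (C : Set ℕ) : Set (Set ℕ) :=
  Set.range fun n : ℕ => {k : ℕ | (k + n) * (k + n) + k ∈ C}

/-- `T` has a `β`-model. -/
def L2Theory.HasBetaModel (T : L2Theory) : Prop :=
  ∃ S : Set (Set ℕ), IsL2BetaModel S ∧ (omegaModel S).Models T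

/-- The relation `S <_β T` on theories extending `T₀`: every `β`-model `M` of `T` contains (a code
of) a `β`-model `N` of `S`. -/
def L2BetaLT (T₀ S T : L2Theory) : Prop :=
  S.Extends T₀ ∧ T.Extends T₀ ∧
    ∀ M : Set (Set ℕ), IsL2BetaModel M → (omegaModel M).Models T →
      ∃ C ∈ M, IsL2BetaModel (decode C) ∧ (omegaModel (decode C)).Models S

/-! ## Set theory -/

/-- The only symbol of the language of set theory, the binary relation symbol `∈`. -/
inductive SetRel : ℕ → Type
  | mem : SetRel 2

/-- The language `{∈}` of set theory. -/
def setLang : FirstOrder.Language.{0, 0} := ⟨fun _ => Empty, SetRel⟩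

abbrev SetTheory : Type := setLang.Theory

/-- `T` extends `U`: every sentence of `U` is a logical consequence of `T`. -/
def SetTheory.Extends (T U : SetTheory) : Prop := ∀ φ ∈ U, T ⊨ᵇ φ

/-! Formulas of set theory; the bound variables of Mathlib's formulas are de Bruijn levels. -/

/-- The variable of level `k`. -/
def ix {n : ℕ} (k : ℕ) (h : k < n := by omega) : Fin n := ⟨k, h⟩

/-- `x ∈ y`. -/
def memF {n : ℕ} (x y : Fin n) : setLang.BoundedFormula Empty n :=
  Relations.boundedFormula₂ (L := setLang) SetRel.mem (&x) (&y)

/-- `x = y`. -/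
def eqF {n : ℕ} (x y : Fin n) : setLang.BoundedFormula Empty n := (&x) =' (&y)

/-- `z = {x, y}`. -/
def isUPairF {n : ℕ} (z x y : Fin n) : setLang.BoundedFormula Empty n :=
  ∀' (memF (ix n) z.castSucc ⇔ (eqF (ix n) x.castSucc ⊔ eqF (ix n) y.castSucc))

/-- `p = ⟨x, y⟩ = {{x}, {x, y}}`. -/
def isPairF {n : ℕ} (p x y : Fin n) : setLang.BoundedFormula Empty n :=
  ∃' ∃' (isUPairF (ix n) (x.castAdd 2) (x.castAdd 2) ⊓
    (isUPairF (ix (n + 1)) (x.castAdd 2) (y.castAdd 2) ⊓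
      isUPairF (p.castAdd 2) (ix n) (ix (n + 1))))

/-- `⟨x, y⟩ ∈ r`. -/
def pairMemF {n : ℕ} (x y r : Fin n) : setLang.BoundedFormula Empty n :=
  ∃' (memF (ix n) r.castSucc ⊓ isPairF (ix n) x.castSucc y.castSucc)

/-- `r` is a relation, that is, a set of ordered pairs. -/
def isRelationF {n : ℕ} (r : Fin n) : setLang.BoundedFormula Empty n :=
  ∀' (memF (ix n) r.castSucc ⟹ ∃' ∃' isPairF (ix n) (ix (n + 1)) (ix (n + 2)))

/-- Every nonempty set `u` has an element `x` such that `⟨y, x⟩ ∉ r` for all `y ∈ u`. -/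
def isRegularF {n : ℕ} (r : Fin n) : setLang.BoundedFormula Empty n :=
  ∀' ((∃' memF (ix (n + 1)) (ix n)) ⟹ ∃' (memF (ix (n + 1)) (ix n) ⊓
    ∀' (memF (ix (n + 2)) (ix n) ⟹ ∼(pairMemF (ix (n + 2)) (ix (n + 1)) (r.castAdd 3)))))

/-- `f` is a function, that is, a single-valued relation. -/
def isFunctionF {n : ℕ} (f : Fin n) : setLang.BoundedFormula Empty n :=
  isRelationF f ⊓ ∀' ∀' ∀' (pairMemF (ix n) (ix (n + 1)) (f.castAdd 3) ⟹
    (pairMemF (ix n) (ix (n + 2)) (f.castAdd 3) ⟹ eqF (ix (n + 1)) (ix (n + 2))))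

/-- The domain of `f` is the field of `r`. -/
def domEqFieldF {n : ℕ} (f r : Fin n) : setLang.BoundedFormula Empty n :=
  ∀' ((∃' pairMemF (ix n) (ix (n + 1)) (f.castAdd 2)) ⇔
    ∃' (pairMemF (ix n) (ix (n + 1)) (r.castAdd 2) ⊔ pairMemF (ix (n + 1)) (ix n) (r.castAdd 2)))

/-- `f(x) = {f(y) | ⟨y, x⟩ ∈ r}` for all `x` in the domain of `f`: for all `x`, `v` with
`⟨x, v⟩ ∈ f` and all `w`, we have `w ∈ v` iff there is `y` with `⟨y, x⟩ ∈ r` and `⟨y, w⟩ ∈ f`. -/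
def isCollapseF {n : ℕ} (f r : Fin n) : setLang.BoundedFormula Empty n :=
  ∀' ∀' (pairMemF (ix n) (ix (n + 1)) (f.castAdd 2) ⟹
    ∀' (memF (ix (n + 2)) (ix (n + 1)) ⇔
      ∃' (pairMemF (ix (n + 3)) (ix n) (r.castAdd 4) ⊓
        pairMemF (ix (n + 3)) (ix (n + 2)) (f.castAdd 4))))

/-- Axiom `Beta`: every regular relation `r` has a collapsing function `f`. -/
def betaAxiom : setLang.Sentence :=
  ∀' ((isRelationF (ix 0) ⊓ isRegularF (ix 0)) ⟹
    ∃' (isFunctionF (ix 1) ⊓ (domEqFieldF (ix 1) (ix 0) ⊓ isCollapseF (ix 1) (ix 0))))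

def extensionality : setLang.Sentence :=
  ∀' ∀' ((∀' (memF (ix 2) (ix 0) ⇔ memF (ix 2) (ix 1))) ⟹ eqF (ix 0) (ix 1))

def foundation : setLang.Sentence :=
  ∀' ((∃' memF (ix 1) (ix 0)) ⟹
    ∃' (memF (ix 1) (ix 0) ⊓ ∀' (memF (ix 2) (ix 1) ⟹ ∼(memF (ix 2) (ix 0)))))

/-- There is a set that contains `∅` and is closed under `y ↦ y ∪ {y}`. -/
def infinity : setLang.Sentence :=
  ∃' ((∃' (memF (ix 1) (ix 0) ⊓ ∀' ∼(memF (ix 2) (ix 1)))) ⊓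
    ∀' (memF (ix 1) (ix 0) ⟹ ∃' (memF (ix 2) (ix 0) ⊓
      ∀' (memF (ix 3) (ix 2) ⇔ (memF (ix 3) (ix 1) ⊔ eqF (ix 3) (ix 1))))))

/-! ### Primitive recursive set theory -/

/-- (Descriptions of) primitive recursive set functions of `n` arguments. -/
inductive PRSFun : ℕ → Type
  /-- `(x₀, …, xₙ₋₁) ↦ xᵢ` -/
  | proj {n : ℕ} (i : Fin n) : PRSFun n
  /-- `(x₀, …, xₙ₋₁) ↦ ∅` -/
  | empty {n : ℕ} : PRSFun n
  /-- `(x, y) ↦ x ∪ {y}` -/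
  | adjoin : PRSFun 2
  /-- `(x, y, u, v) ↦ x` if `u ∈ v`, and `y` otherwise -/
  | cond : PRSFun 4
  /-- `x ↦ g(h₀(x), …, hₘ₋₁(x))` -/
  | comp {n m : ℕ} (g : PRSFun m) (h : Fin m → PRSFun n) : PRSFun n
  /-- the function `f` with `f(z, x) = g(⋃ {f(u, x) | u ∈ z}, z, x)` -/
  | recur {n : ℕ} (g : PRSFun (n + 2)) : PRSFun (n + 1)

/-- The language with `∈` and a function symbol for each primitive recursive set function. -/
def prsLang : FirstOrder.Language.{0, 0} := ⟨PRSFun, SetRel⟩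

/-- The inclusion of the language `{∈}`. -/
def prsIncl : setLang →ᴸ prsLang where
  onFunction := fun {_} f => f.elim
  onRelation := fun {_} r => r

/-- The variable of level `k`, as a term. -/
def bv {n : ℕ} (k : ℕ) (h : k < n := by omega) : prsLang.Term (Empty ⊕ Fin n) := &(ix k h)

/-- The term `f(t₀, …, tₗ₋₁)`. -/
def app {n l : ℕ} (f : PRSFun l) (t : Fin l → prsLang.Term (Empty ⊕ Fin n)) :
    prsLang.Term (Empty ⊕ Fin n) := Term.func (L := prsLang) f t

/-- `s ∈ t`. -/
def memT {n : ℕ} (s t : prsLang.Term (Empty ⊕ Fin n)) : prsLang.BoundedFormula Empty n :=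
  Relations.boundedFormula₂ (L := prsLang) SetRel.mem s t

/-- Universal closure. -/
def close (n : ℕ) (φ : prsLang.BoundedFormula Empty n) : prsLang.Sentence := φ.alls

/-- The axioms of primitive recursive set theory. -/
inductive PRSAxiom : prsLang.Sentence → Prop
  | extensionality : PRSAxiom (prsIncl.onSentence extensionality)
  | foundation : PRSAxiom (prsIncl.onSentence foundation)
  | infinity : PRSAxiom (prsIncl.onSentence infinity)
  | proj {n : ℕ} (i : Fin n) :
      PRSAxiom (close n (app (.proj i) (fun j : Fin n => bv j) =' bv i))
  | empty {n : ℕ} :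
      PRSAxiom (close n (∀' ∼(memT (bv n) (app .empty (fun j : Fin n => bv j)))))
  | adjoin : PRSAxiom (∀' ∀' ∀' (memT (bv 2) (app .adjoin ![bv 0, bv 1]) ⇔
      (memT (bv 2) (bv 0) ⊔ bv 2 =' bv 1)))
  | cond : PRSAxiom (∀' ∀' ∀' ∀'
      ((memT (bv 2) (bv 3) ⟹ app .cond ![bv 0, bv 1, bv 2, bv 3] =' bv 0) ⊓
        (∼(memT (bv 2) (bv 3)) ⟹ app .cond ![bv 0, bv 1, bv 2, bv 3] =' bv 1)))
  | comp {n m : ℕ} (g : PRSFun m) (h : Fin m → PRSFun n) :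
      PRSAxiom (close n (app (.comp g h) (fun j : Fin n => bv j) ='
        app g (fun i => app (h i) (fun j : Fin n => bv j))))
  /-- With `z` of level `0`, `x = (x₁, …, xₙ)` of levels `1, …, n`, and `f = recur g`: there is `w`
  with `w = ⋃ {f(u, x) | u ∈ z}` and `f(z, x) = g(w, z, x)`. -/
  | recur {n : ℕ} (g : PRSFun (n + 2)) :
      PRSAxiom (close (n + 1) (∃' ((∀' (memT (bv (n + 2)) (bv (n + 1)) ⇔
          ∃' (memT (bv (n + 3)) (bv 0) ⊓ memT (bv (n + 2))
            (app (.recur g) (Fin.cons (bv (n + 3)) (fun j : Fin n => bv (j + 1))))))) ⊓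
        app (.recur g) (fun j : Fin (n + 1) => bv j) ='
          app g (Fin.cons (bv (n + 1)) (fun j : Fin (n + 1) => bv j)))))

/-- The consequences in the language `{∈}` of primitive recursive set theory. -/
def PRS : SetTheory := {φ | ({ψ | PRSAxiom ψ} : prsLang.Theory) ⊨ᵇ prsIncl.onSentence φ}

/-- `PRS + Beta`. -/
def PRSBeta : SetTheory := PRS ∪ {betaAxiom}

/-! ### `β`-models of set theory -/

section Models

variable {M : Type u} [setLang.Structure M]

/-- The membership relation of `M`. -/
def Memb (x y : M) : Prop := Structure.RelMap (L := setLang) SetRel.mem ![x, y]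

/-- `M ⊨ z = {x, y}` -/
def IsUPair (z x y : M) : Prop := ∀ w : M, Memb w z ↔ w = x ∨ w = y

/-- `M ⊨ p = ⟨x, y⟩` -/
def IsPair (p x y : M) : Prop := ∃ a b : M, IsUPair a x x ∧ IsUPair b x y ∧ IsUPair p a b

/-- `M ⊨ ⟨x, y⟩ ∈ r` -/
def PairMemb (x y r : M) : Prop := ∃ p : M, Memb p r ∧ IsPair p x y

/-- `c ∈ M` is, in the sense of `M`, a structure for the language of set theory: an ordered pair
`⟨A, E⟩` with `E ⊆ A × A`. -/
def IsStructureCode (c A E : M) : Prop :=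
  IsPair c A E ∧ ∀ p : M, Memb p E → ∃ x y : M, Memb x A ∧ Memb y A ∧ IsPair p x y

/-- The domain of the structure coded by `⟨A, E⟩`. -/
def Coded (A _E : M) : Type u := {x : M // Memb x A}

/-- The membership relation of the structure coded by `⟨A, E⟩`. -/
def codedRel (A E : M) : {n : ℕ} → SetRel n → (Fin n → Coded A E) → Prop
  | _, .mem, xs => PairMemb (xs 0).1 (xs 1).1 E

instance (A E : M) : setLang.Structure (Coded A E) where
  funMap := fun {_} f _ => Empty.elim f
  RelMap := fun {_} r xs => codedRel A E r xs

end Models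

/-- A `β`-model of set theory: a well-founded structure satisfying `PRS`. -/
def IsSetBetaModel (M : Type u) [setLang.Structure M] : Prop :=
  WellFounded (Memb : M → M → Prop) ∧ M ⊨ PRS

/-- `T` has a `β`-model. -/
def SetTheory.HasBetaModel (T : SetTheory) : Prop :=
  ∃ (M : Type u) (_ : setLang.Structure M), IsSetBetaModel M ∧ M ⊨ T

/-- The relation `S <_β T` on theories extending `T₀`: every `β`-model `M` of `T` contains a
`β`-model `N` of `S`. -/
def SetBetaLT (T₀ S T : SetTheory) : Prop :=
  S.Extends T₀ ∧ T.Extends T₀ ∧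
    ∀ (M : Type u) [setLang.Structure M], IsSetBetaModel M → M ⊨ T →
      ∃ c A E : M, IsStructureCode c A E ∧ IsSetBetaModel (Coded A E) ∧ Coded A E ⊨ S

end BetaRank

/-!
Membership between `β`-models is well-founded: every `β`-model `M` has an ordinal height, and
`N ∈ M` implies that the height of `N` is smaller than that of `M`. A countable `β`-model has only
countably many members, which are countable themselves. By induction along membership, each
countable `β`-model `M` thus has a countable ordinal that bounds the rank of every theory true in
`M`: if `S <_β T` and `M` satisfies `T`, some `N ∈ M` satisfies `S`, and the supremum over `N ∈ M` of
the successors of the bounds for `N` is a bound for `M` (`exists_rank_le_of_acc`). By the downward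
Löwenheim–Skolem theorem, a theory with a `β`-model has a countable one
(`L2Theory.HasBetaModel.exists_countable`, `SetTheory.HasBetaModel.exists_countable`).

In second-order arithmetic the height of `M` is the least ordinal greater than all ranks of numbers
with respect to well-founded relations coded in `M`. If `C ∈ M` codes the `β`-model `N`, then `N` recognises correctly which of
its members code well-founded relations, so that the disjoint sum of these relations is
arithmetical in `C`. It therefore belongs to `M`, and with a top element added it has greater rank
than each of them (`height_decode_lt`).

In set theory the height of `M` is the least ordinal greater than the ranks of its elements. If `N ∈ M` is given by
`⟨A, E⟩`, axiom `Beta` provides a collapsing function `f ∈ M` of `E`. Collapsing does not lower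
ranks, and all values of `f` have rank below that of `f` (`CountableBetaModel.Mem.height_lt`).
-/

namespace BetaRank

/-! ### Ranks -/

theorem rank_le_rank_of_hom {α β : Type u} {r : α → α → Prop} {s : β → β → Prop}
    (hr : WellFounded r) (hs : WellFounded s) (f : α → β) (hf : ∀ a b, r a b → s (f a) (f b))
    (a : α) : (hr.apply a).rank ≤ (hs.apply (f a)).rank := by
  induction a using hr.induction with
  | _ a ih =>
    rw [(hr.apply a).rank_eq]
    exact Ordinal.iSup_le fun b => Order.succ_le_of_lt
      ((ih b b.2).trans_lt ((hs.apply (f a)).rank_lt_of_rel (hf _ _ b.2)))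

/-- Countable bounds for ranks transfer from models to theories. Here `R N M` stands for `N ∈ M`
and `L S T` for `S <_β T`. The bound `β` depends on the model only; this makes the supremum over
the countably many members of `M` a bound for the possibly uncountably many predecessors of
`T`. -/
theorem exists_rank_le_of_acc {𝓜 : Type*} {Θ : Type} {R : 𝓜 → 𝓜 → Prop} {L : Θ → Θ → Prop}
    {sat : 𝓜 → Θ → Prop} (hR : ∀ M, {N | R N M}.Countable)
    (hL : ∀ M S T, L S T → sat M T → ∃ N, R N M ∧ sat N S) {M : 𝓜} (hM : Acc R M) :
    ∃ β < ω₁, ∀ T, sat M T → ∃ h : Acc L T, h.rank ≤ β := by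
  induction hM with
  | intro M _ ih =>
    choose b hb hbT using ih
    have := (hR M).to_subtype
    have : Countable {N // R N M} := this
    refine ⟨⨆ N : {N // R N M}, Order.succ (b N.1 N.2), ?_, fun T hT => ?_⟩
    · exact Ordinal.iSup_lt_omega_one fun N =>
        (Cardinal.isSuccLimit_omega 1).succ_lt (hb N.1 N.2)
    · have key : ∀ S, L S T → ∃ N : {N // R N M}, ∃ h : Acc L S, h.rank ≤ b N.1 N.2 :=
        fun S hS => by
          obtain ⟨N, hN, hNS⟩ := hL M S T hS hT
          exact ⟨⟨N, hN⟩, hbT N hN S hNS⟩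
      have hT' : Acc L T := ⟨T, fun S hS => (key S hS).choose_spec.choose⟩
      refine ⟨hT', ?_⟩
      rw [hT'.rank_eq]
      refine Ordinal.iSup_le fun S => ?_
      obtain ⟨N, h, hN⟩ := key S.1 S.2
      have hbdd : BddAbove (Set.range fun N : {N // R N M} => Order.succ (b N.1 N.2)) :=
        ⟨ω₁, by
          rintro _ ⟨N, rfl⟩
          exact ((Cardinal.isSuccLimit_omega 1).succ_lt (hb N.1 N.2)).le⟩
      exact (Order.succ_le_succ hN).trans (le_ciSup hbdd N)

/-! ### Second-order arithmetic: countable elementary submodels -/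

/-- An injective numbering of terms. -/
def L2Term.code {n : ℕ} : L2Term n → ℕ
  | .var i => Nat.pair 0 i
  | .zero => Nat.pair 1 0
  | .one => Nat.pair 2 0
  | .add s t => Nat.pair 3 (Nat.pair s.code t.code)
  | .mul s t => Nat.pair 4 (Nat.pair s.code t.code)

theorem L2Term.code_injective {n : ℕ} : Function.Injective (L2Term.code (n := n)) := by
  intro s
  induction s with
  | var i => intro t h; cases t <;> simp_all [code, Fin.ext_iff]
  | zero => intro t h; cases t <;> simp_all [code]
  | one => intro t h; cases t <;> simp_all [code]
  | add s₁ s₂ h₁ h₂ =>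
    intro t h; cases t <;> simp [code] at h
    rw [h₁ h.1, h₂ h.2]
  | mul s₁ s₂ h₁ h₂ =>
    intro t h; cases t <;> simp [code] at h
    rw [h₁ h.1, h₂ h.2]

/-- An injective numbering of the formulas with given variables. -/
def L2Formula.code : {n m : ℕ} → L2Formula n m → ℕ
  | _, _, .eq s t => Nat.pair 0 (Nat.pair s.code t.code)
  | _, _, .lt s t => Nat.pair 1 (Nat.pair s.code t.code)
  | _, _, .mem t X => Nat.pair 2 (Nat.pair t.code X)
  | _, _, .falsum => Nat.pair 3 0
  | _, _, .imp φ ψ => Nat.pair 4 (Nat.pair φ.code ψ.code)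
  | _, _, .allNum φ => Nat.pair 5 φ.code
  | _, _, .allSet φ => Nat.pair 6 φ.code

theorem L2Formula.code_injective {n m : ℕ} :
    Function.Injective (L2Formula.code (n := n) (m := m)) := by
  intro φ
  induction φ with
  | eq s t => intro ψ h; cases ψ <;> simp_all [code, L2Term.code_injective.eq_iff]
  | lt s t => intro ψ h; cases ψ <;> simp_all [code, L2Term.code_injective.eq_iff]
  | mem t X => intro ψ h; cases ψ <;> simp_all [code, L2Term.code_injective.eq_iff, Fin.ext_iff]
  | falsum => intro ψ h; cases ψ <;> simp_all [code]
  | imp φ₁ φ₂ h₁ h₂ =>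
    intro ψ h; cases ψ <;> simp [code] at h
    rw [h₁ h.1, h₂ h.2]
  | allNum φ ih =>
    intro ψ h; cases ψ <;> simp [code] at h
    rw [ih h]
  | allSet φ ih =>
    intro ψ h; cases ψ <;> simp [code] at h
    rw [ih h]

instance L2Formula.countable {n m : ℕ} : Countable (L2Formula n m) :=
  L2Formula.code_injective.countable

/-- Labels of Skolem functions: a formula with a distinguished set variable and values of its
number variables. The arguments of the function are the values of the other set variables. -/
abbrev SkolemLabel : Type := Σ p : ℕ × ℕ, L2Formula p.1 (p.2 + 1) × (Fin p.1 → ℕ)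

/-- The value at `W` of the Skolem function of `l`: a member of `S` falsifying the formula, if
there is one. -/
noncomputable def skolem {S : Set (Set ℕ)} (X₀ : S) (l : SkolemLabel) (W : Fin l.1.2 → S) : S :=
  open Classical in
  if h : ∃ A : S, ¬ l.2.1.Sat (omegaModel S) l.2.2 (Fin.snoc W A) then h.choose else X₀

/-- The value of a closed Skolem term; such terms are well-founded trees of labels. -/
noncomputable def skolemEval {S : Set (Set ℕ)} (X₀ : S) :
    WType (fun l : SkolemLabel => Fin l.1.2) → S :=
  WType.elim S fun p => skolem X₀ p.1 p.2

theorem snoc_inclusion {S S' : Set (Set ℕ)} (h : S' ⊆ S) {m : ℕ} (W : Fin m → S') (A : S') :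
    (fun i => Set.inclusion h ((Fin.snoc W A : Fin (m + 1) → S') i)) =
      (Fin.snoc (fun i => Set.inclusion h (W i)) (Set.inclusion h A) : Fin (m + 1) → S) := by
  funext i
  refine Fin.lastCases ?_ (fun i => ?_) i <;> simp

theorem L2Term.eval_omegaModel (S S' : Set (Set ℕ)) {n : ℕ} (t : L2Term n) (v : Fin n → ℕ) :
    t.eval (omegaModel S') v = t.eval (omegaModel S) v := by
  induction t with
  | add s t hs ht => simp only [eval, hs, ht]; rfl
  | mul s t hs ht => simp only [eval, hs, ht]; rfl
  | _ => rfl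

/-- Downward Löwenheim–Skolem theorem for `ω`-models: the values of the closed Skolem terms form
an elementary submodel, by the Tarski–Vaught criterion. -/
theorem exists_countable_elementary {S : Set (Set ℕ)} (hS : S.Nonempty) :
    ∃ (S' : Set (Set ℕ)) (h : S' ⊆ S), S'.Countable ∧
      ∀ (n m : ℕ) (φ : L2Formula n m) (v : Fin n → ℕ) (W : Fin m → S'),
        φ.Sat (omegaModel S') v W ↔
          φ.Sat (omegaModel S) v fun i => Set.inclusion h (W i) := by
  obtain ⟨X, hX⟩ := hS
  let e : WType (fun l : SkolemLabel => Fin l.1.2) → Set ℕ := fun w => skolemEval ⟨X, hX⟩ w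
  have hsub : Set.range e ⊆ S := by
    rintro _ ⟨w, rfl⟩
    exact (skolemEval ⟨X, hX⟩ w).2
  have hcount : Countable (WType fun l : SkolemLabel => Fin l.1.2) := by
    have := Encodable.ofCountable SkolemLabel
    infer_instance
  refine ⟨Set.range e, hsub, Set.countable_range e, fun n m φ => ?_⟩
  induction φ with
  | eq s t => intro v W; simp only [L2Formula.Sat, L2Term.eval_omegaModel S (Set.range e)]; rfl
  | lt s t => intro v W; simp only [L2Formula.Sat, L2Term.eval_omegaModel S (Set.range e)]; rfl
  | mem t X => intro v W; simp only [L2Formula.Sat, L2Term.eval_omegaModel S (Set.range e)]; rfl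
  | falsum => intro v W; rfl
  | imp φ ψ hφ hψ => intro v W; simp only [L2Formula.Sat, hφ, hψ]
  | allNum φ ih => intro v W; exact forall_congr' fun a => ih _ _
  | @allSet n m φ ih =>
    intro v W
    constructor
    · intro h
      by_contra hne
      have hne' : ∃ A : S, ¬ φ.Sat (omegaModel S) v
          (Fin.snoc (fun i => Set.inclusion hsub (W i)) A) := not_forall.1 hne
      choose w hw using fun i => (W i).2
      have hW : (fun i => skolemEval ⟨X, hX⟩ (w i)) = fun i => Set.inclusion hsub (W i) :=
        funext fun i => Subtype.ext (hw i)
      let l : SkolemLabel := ⟨(n, m), φ, v⟩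
      have hval : skolemEval ⟨X, hX⟩ (⟨l, w⟩ : WType fun l : SkolemLabel => Fin l.1.2) =
          hne'.choose := (congrArg (skolem ⟨X, hX⟩ l) hW).trans (dif_pos hne')
      have hsat := Eq.subst (motive := fun W => φ.Sat (omegaModel S) v W)
        (snoc_inclusion hsub W _) ((ih v _).1 (h ⟨e ⟨l, w⟩, ⟨l, w⟩, rfl⟩))
      exact hne'.choose_spec (Eq.subst (motive := fun A => φ.Sat (omegaModel S) v
        (Fin.snoc (fun i => Set.inclusion hsub (W i)) A)) hval hsat)
    · intro h A
      exact (ih v _).2 (Eq.subst (motive := fun W => φ.Sat (omegaModel S) v W)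
        (snoc_inclusion hsub W A).symm (h _))

theorem IsL2BetaModel.nonempty {S : Set (Set ℕ)} (hS : IsL2BetaModel S) : S.Nonempty := by
  have h := (hS 0 0 (.imp .falsum .falsum) ⟨trivial, trivial⟩ Fin.elim0 Fin.elim0).2
    fun h => h ⟨∅, Set.mem_univ _⟩ id
  by_contra hne
  exact h fun A => (hne ⟨A.1, A.2⟩).elim

/-- Elementary submodels of `β`-models are `β`-models. -/
theorem L2Theory.HasBetaModel.exists_countable {T : L2Theory} (hT : T.HasBetaModel) :
    ∃ S : Set (Set ℕ), S.Countable ∧ IsL2BetaModel S ∧ (omegaModel S).Models T := by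
  obtain ⟨S, hS, hST⟩ := hT
  obtain ⟨S', h, hc, hS'⟩ := exists_countable_elementary hS.nonempty
  refine ⟨S', hc, fun n m θ hθ v W => (hS' _ _ _ v W).trans (hS n m θ hθ v _), fun σ hσ => ?_⟩
  refine (hS' 0 0 σ Fin.elim0 Fin.elim0).2 ?_
  exact Eq.subst (motive := fun W => σ.Sat (omegaModel S) Fin.elim0 W)
    (funext fun i => i.elim0) (hST σ hσ)

/-! ### Second-order arithmetic: heights of `β`-models -/

/-- The binary relation coded by `X`. -/
def rel (X : Set ℕ) (a b : ℕ) : Prop := (a + b) * (a + b) + a ∈ X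

namespace L2Formula

variable {M : L2Structure.{u}} {n m : ℕ} {v : Fin n → M.Num} {W : Fin m → M.Sets}

theorem sat_neg {φ : L2Formula n m} : φ.neg.Sat M v W ↔ ¬ φ.Sat M v W := Iff.rfl

theorem sat_imp {φ ψ : L2Formula n m} :
    (φ.imp ψ).Sat M v W ↔ (φ.Sat M v W → ψ.Sat M v W) := Iff.rfl

theorem sat_allNum {φ : L2Formula (n + 1) m} :
    φ.allNum.Sat M v W ↔ ∀ a, φ.Sat M (Fin.snoc v a) W := Iff.rfl

theorem sat_and {φ ψ : L2Formula n m} : (φ.and ψ).Sat M v W ↔ φ.Sat M v W ∧ ψ.Sat M v W := by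
  simp [L2Formula.and, neg, Sat]

theorem sat_or {φ ψ : L2Formula n m} : (φ.or ψ).Sat M v W ↔ φ.Sat M v W ∨ ψ.Sat M v W := by
  simp only [L2Formula.or, neg, Sat]; tauto

theorem sat_iff {φ ψ : L2Formula n m} :
    (φ.iff ψ).Sat M v W ↔ (φ.Sat M v W ↔ ψ.Sat M v W) := by
  simp only [L2Formula.iff, sat_and, Sat]; tauto

theorem sat_exNum {φ : L2Formula (n + 1) m} :
    φ.exNum.Sat M v W ↔ ∃ a, φ.Sat M (Fin.snoc v a) W := by
  simp [exNum, neg, Sat]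

theorem sat_exSet {φ : L2Formula n (m + 1)} :
    φ.exSet.Sat M v W ↔ ∃ A, φ.Sat M v (Fin.snoc W A) := by
  simp [exSet, neg, Sat]

/-- `Z` (of level `1`) is nonempty and has no minimal element with respect to the relation coded
by `X` (of level `0`). -/
def noMinimal : L2Formula 0 2 :=
  (exNum (mem (nv 0) (sv 1))).and
    (allNum ((mem (nv 0) (sv 1)).imp (exNum ((mem (nv 1) (sv 1)).and (leIn (sv 0) (nv 1) (nv 0))))))

/-- With the number variable of level `2` as `n`: every nonempty set coded by `C` (of level `0`)
has a minimal element with respect to the relation coded by `(C)ₙ`. -/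
def wfIn : L2Formula 3 2 :=
  allNum ((exNum (mem ((nv 4).pair (nv 3)) (sv 0))).imp
    (exNum ((mem ((nv 4).pair (nv 3)) (sv 0)).and
      (allNum ((mem ((nv 5).pair (nv 3)) (sv 0)).imp
        (mem (((nv 5).pair (nv 4)).pair (nv 2)) (sv 0)).neg)))))

/-- The formula expressing `IsAmalgam`, with `C` of level `0` and `Y` of level `1`. -/
def isAmalgam : L2Formula 0 2 :=
  allNum (allNum ((leIn (sv 1) (nv 0) (nv 1)).iff
    (((eq (nv 1) .zero).and (eq (nv 0) .zero).neg).or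
      (exNum (wfIn.and (exNum (exNum
        ((eq (nv 0) (((nv 3).pair (nv 2)).add .one)).and
        ((eq (nv 1) (((nv 4).pair (nv 2)).add .one)).and
          (mem (((nv 3).pair (nv 4)).pair (nv 2)) (sv 0)))))))))))

theorem noMinimal_arithmetical : noMinimal.Arithmetical := by
  simp [noMinimal, L2Formula.and, neg, exNum, leIn, Arithmetical]

theorem isAmalgam_arithmetical : isAmalgam.Arithmetical := by
  simp [isAmalgam, wfIn, L2Formula.iff, L2Formula.and, L2Formula.or, neg, exNum, leIn,
    Arithmetical]

theorem sat_noMinimal {S : Set (Set ℕ)} {v : Fin 0 → (omegaModel S).Num}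
    {W : Fin 2 → (omegaModel S).Sets} : noMinimal.Sat (omegaModel S) v W ↔
      (W 1).1.Nonempty ∧ ∀ k ∈ (W 1).1, ∃ l ∈ (W 1).1, rel (W 0).1 l k := by
  simp only [noMinimal, sat_and, sat_exNum, sat_allNum, sat_imp]
  rfl

end L2Formula

/-- The number coding the pair `(m, n)`. -/
def pairCode (m n : ℕ) : ℕ := (m + n) * (m + n) + m

/-- Every nonempty set coded by `C` has a minimal element with respect to the relation coded by
`(C)ₙ`. -/
def WfIn (C : Set ℕ) (n : ℕ) : Prop :=
  ∀ j, (∃ k, pairCode k j ∈ C) → ∃ k, pairCode k j ∈ C ∧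
    ∀ l, pairCode l j ∈ C → ¬ pairCode (pairCode l k) n ∈ C

/-- `Y` codes the disjoint sum of the relations coded by those `(C)ₙ` that satisfy `WfIn`, with a
top element added. The number `0` is the top element, and `pairCode m n + 1` is the copy of `m` in
the `n`-th summand. -/
def IsAmalgam (C Y : Set ℕ) : Prop :=
  ∀ a b, rel Y a b ↔ (b = 0 ∧ ¬ a = 0) ∨
    ∃ n, WfIn C n ∧ ∃ m m', a = pairCode m n + 1 ∧ b = pairCode m' n + 1 ∧
      pairCode (pairCode m m') n ∈ C

namespace L2Formula
theorem sat_isAmalgam {S : Set (Set ℕ)} {v : Fin 0 → (omegaModel S).Num}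
    {W : Fin 2 → (omegaModel S).Sets} : isAmalgam.Sat (omegaModel S) v W ↔
      IsAmalgam (W 0).1 (W 1).1 := by
  simp only [isAmalgam, wfIn, sat_and, sat_or, sat_iff, sat_neg, sat_exNum, sat_allNum, sat_imp]
  rfl
end L2Formula

theorem pairCode_inj {m n m' n' : ℕ} : pairCode m n = pairCode m' n' ↔ m = m' ∧ n = n' := by
  refine ⟨fun h => ?_, fun ⟨h, h'⟩ => by rw [h, h']⟩
  have key : m + n = m' + n' := by
    unfold pairCode at h
    rcases lt_trichotomy (m + n) (m' + n') with hlt | heq | hlt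
    · nlinarith
    · exact heq
    · nlinarith
  have : m = m' := by unfold pairCode at h; rw [key] at h; omega
  omega

/-- Well-foundedness in a `β`-model is well-foundedness, being the negation of a `Σ¹₁` formula. -/
theorem IsL2BetaModel.wellFounded_rel {S : Set (Set ℕ)} (hS : IsL2BetaModel S) {X : Set ℕ}
    (hX : X ∈ S) (h : ∀ Z ∈ S, Z.Nonempty → ∃ k ∈ Z, ∀ l ∈ Z, ¬ rel X l k) :
    WellFounded (rel X) := by
  rw [WellFounded.wellFounded_iff_has_min]
  intro Z hZ
  by_contra! hmin
  have hβ := hS 0 1 L2Formula.noMinimal L2Formula.noMinimal_arithmetical Fin.elim0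
    fun _ => ⟨X, hX⟩
  obtain ⟨A, hA⟩ := L2Formula.sat_exSet.1 (hβ.2 (L2Formula.sat_exSet.2
    ⟨⟨Z, Set.mem_univ _⟩, L2Formula.sat_noMinimal.2 ⟨hZ, hmin⟩⟩))
  obtain ⟨hne, hA⟩ := L2Formula.sat_noMinimal.1 hA
  obtain ⟨k, hk, hkl⟩ := h A.1 A.2 hne
  obtain ⟨l, hl, hlk⟩ := hA k hk
  exact hkl l hl hlk

/-- The existence of an amalgam is `Σ¹₁` in `C` and true in `𝒫(ℕ)`, hence true in `S`. -/
theorem IsL2BetaModel.exists_isAmalgam {S : Set (Set ℕ)} (hS : IsL2BetaModel S) {C : Set ℕ}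
    (hC : C ∈ S) : ∃ Y ∈ S, IsAmalgam C Y := by
  have hβ := hS 0 1 L2Formula.isAmalgam L2Formula.isAmalgam_arithmetical Fin.elim0
    fun _ => ⟨C, hC⟩
  let Φ : ℕ → ℕ → Prop := fun a b => (b = 0 ∧ ¬ a = 0) ∨
    ∃ n, WfIn C n ∧ ∃ m m', a = pairCode m n + 1 ∧ b = pairCode m' n + 1 ∧
      pairCode (pairCode m m') n ∈ C
  obtain ⟨A, hA⟩ := L2Formula.sat_exSet.1 <| hβ.2 <| L2Formula.sat_exSet.2
    ⟨⟨{p | ∃ a b, p = pairCode a b ∧ Φ a b}, Set.mem_univ _⟩,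
    L2Formula.sat_isAmalgam.2 fun a b =>
      ⟨fun ⟨a', b', h, hΦ⟩ => by
        obtain ⟨rfl, rfl⟩ := pairCode_inj.1 h
        exact hΦ, fun h => ⟨a, b, rfl, h⟩⟩⟩
  exact ⟨A.1, A.2, L2Formula.sat_isAmalgam.1 hA⟩

/-- The section `(C)ₙ`. -/
def sec (C : Set ℕ) (n : ℕ) : Set ℕ := {k | pairCode k n ∈ C}

/-- Among the sections of a code of a `β`-model, those coding well-founded relations are singled out
by a condition arithmetical in the code. -/
theorem wfIn_iff {C : Set ℕ} (hC : IsL2BetaModel (decode C)) (n : ℕ) :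
    WfIn C n ↔ WellFounded (rel (sec C n)) := by
  constructor
  · intro h
    refine hC.wellFounded_rel ⟨n, rfl⟩ ?_
    rintro _ ⟨j, rfl⟩ hne
    exact h j hne
  · intro h j hj
    exact h.has_min (sec C j) hj

theorem IsAmalgam.wellFounded {C Y : Set ℕ} (hC : IsL2BetaModel (decode C))
    (hY : IsAmalgam C Y) : WellFounded (rel Y) := by
  have h₁ : ∀ n, WfIn C n → ∀ m, Acc (rel Y) (pairCode m n + 1) := by
    intro n hn m
    have hwf := (wfIn_iff hC n).1 hn
    induction m using hwf.induction with
    | _ m ih =>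
      refine ⟨_, fun a ha => ?_⟩
      obtain ⟨h, -⟩ | ⟨n', -, k, m', rfl, hm, hk⟩ := (hY _ _).1 ha
      · omega
      · obtain ⟨rfl, rfl⟩ := pairCode_inj.1 (Nat.succ_injective hm)
        exact ih k hk
  have h₂ : ∀ b, b ≠ 0 → Acc (rel Y) b := fun b hb => ⟨_, fun a ha => by
    obtain ⟨h, -⟩ | ⟨n, hn, m, -, rfl, -⟩ := (hY _ _).1 ha
    · exact absurd h hb
    · exact h₁ n hn m⟩
  refine ⟨fun b => ?_⟩
  by_cases hb : b = 0
  · refine ⟨_, fun a ha => h₂ a ?_⟩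
    obtain ⟨-, h⟩ | ⟨n, hn, m, -, rfl, -⟩ := (hY _ _).1 ha
    · exact h
    · omega
  · exact h₂ b hb

/-- The height of `S`: the least ordinal greater than the rank of every number with respect to
every well-founded relation coded in `S`. -/
noncomputable def height (S : Set (Set ℕ)) : Ordinal.{0} :=
  ⨆ p : {X // X ∈ S ∧ WellFounded (rel X)} × ℕ, Order.succ (p.1.2.2.apply p.2).rank

theorem rank_lt_height {S : Set (Set ℕ)} {X : Set ℕ} (hX : X ∈ S) (h : WellFounded (rel X))
    (k : ℕ) : (h.apply k).rank < height S :=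
  Order.succ_le_iff.1 (Ordinal.le_iSup
    (fun p : {X // X ∈ S ∧ WellFounded (rel X)} × ℕ => Order.succ (p.1.2.2.apply p.2).rank)
    (⟨X, hX, h⟩, k))

/-- The amalgam of the well-founded relations of `decode C` belongs to `S`, and its top element has
a greater rank than any number with respect to any of these relations. -/
theorem height_decode_lt {S : Set (Set ℕ)} (hS : IsL2BetaModel S) {C : Set ℕ} (hC : C ∈ S)
    (hβ : IsL2BetaModel (decode C)) : height (decode C) < height S := by
  obtain ⟨Y, hYS, hY⟩ := hS.exists_isAmalgam hC
  have hwf := hY.wellFounded hβ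
  refine lt_of_le_of_lt (Ordinal.iSup_le ?_) (rank_lt_height hYS hwf 0)
  rintro ⟨⟨_, ⟨n, rfl⟩, hn⟩, m⟩
  have hn' : WfIn C n := (wfIn_iff hβ n).2 hn
  refine Order.succ_le_of_lt (lt_of_le_of_lt
    (rank_le_rank_of_hom hn hwf (fun m => pairCode m n + 1) (fun a b hab => ?_) m)
    ((hwf.apply 0).rank_lt_of_rel ?_))
  · exact (hY _ _).2 (Or.inr ⟨n, hn', a, b, rfl, rfl, hab⟩)
  · exact (hY _ _).2 (Or.inl ⟨rfl, Nat.succ_ne_zero _⟩)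

/-! ### Second-order arithmetic: countability of the ranks -/

theorem l2_rank_lt_omega_one (T₀ T : L2Theory) (hT : T.HasBetaModel) :
    ∃ h : Acc (L2BetaLT T₀) T, h.rank < ω₁ := by
  obtain ⟨S, hcS, hS, hST⟩ := hT.exists_countable
  let R : {S : Set (Set ℕ) // S.Countable ∧ IsL2BetaModel S} →
      {S : Set (Set ℕ) // S.Countable ∧ IsL2BetaModel S} → Prop :=
    fun N M => ∃ C ∈ M.1, N.1 = decode C
  have hwf : WellFounded R := by
    refine Subrelation.wf (r := InvImage (· < ·) fun M => height M.1) ?_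
      (InvImage.wf _ Ordinal.lt_wf)
    rintro ⟨_, _, hN⟩ ⟨M, _, hM⟩ ⟨C, hC, rfl⟩
    exact height_decode_lt hM hC hN
  have hcount : ∀ M, {N | R N M}.Countable := by
    intro M
    refine ((M.2.1.image decode).preimage Subtype.val_injective).mono ?_
    rintro N ⟨C, hC, h⟩
    exact ⟨C, hC, h.symm⟩
  have hstep : ∀ M S T, L2BetaLT T₀ S T → (omegaModel M.1).Models T →
      ∃ N, R N M ∧ (omegaModel N.1).Models S := fun M S T hST hM => by
    obtain ⟨C, hC, hN, hNS⟩ := hST.2.2 M.1 M.2.2 hM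
    exact ⟨⟨decode C, Set.countable_range _, hN⟩, ⟨C, hC, rfl⟩, hNS⟩
  obtain ⟨β, hβ, h⟩ := exists_rank_le_of_acc hcount hstep (hwf.apply ⟨S, hcS, hS⟩)
  obtain ⟨hacc, hle⟩ := h T hST
  exact ⟨hacc, hle.trans_lt hβ⟩

/-! ### Set theory: semantics of the axioms -/

section Semantics

variable {M : Type u} [setLang.Structure M] {n : ℕ} {e : Empty → M} {v : Fin n → M}

theorem realize_memF {x y : Fin n} : (memF x y).Realize e v ↔ Memb (v x) (v y) := by
  exact (BoundedFormula.realize_rel₂ (L := setLang)).trans (by simp [Memb])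

theorem realize_eqF {x y : Fin n} : (eqF x y).Realize e v ↔ v x = v y := by
  simp [eqF]

theorem castLT_castLT_castAdd_two (i : Fin n) (h : (i.castAdd 2 : ℕ) < n + 1)
    (h' : ((i.castAdd 2).castLT h : ℕ) < n) : ((i.castAdd 2).castLT h).castLT h' = i := rfl

theorem realize_isUPairF {z x y : Fin n} :
    (isUPairF z x y).Realize e v ↔ IsUPair (v z) (v x) (v y) := by
  simp [isUPairF, IsUPair, realize_memF, realize_eqF, ix, Fin.snoc]

theorem realize_isPairF {p x y : Fin n} :
    (isPairF p x y).Realize e v ↔ IsPair (v p) (v x) (v y) := by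
  simp [isPairF, IsPair, realize_isUPairF, ix, Fin.snoc, castLT_castLT_castAdd_two]

theorem realize_pairMemF {x y r : Fin n} :
    (pairMemF x y r).Realize e v ↔ PairMemb (v x) (v y) (v r) := by
  simp [pairMemF, PairMemb, realize_isPairF, realize_memF, ix, Fin.snoc]

/-- The part of axiom `Beta` that is needed here, evaluated in `M`. -/
theorem exists_collapse_of_models_betaAxiom (hM : M ⊨ betaAxiom) {r : M}
    (hrel : ∀ p, Memb p r → ∃ x y, IsPair p x y)
    (hreg : ∀ u : M, (∃ x, Memb x u) → ∃ x, Memb x u ∧ ∀ y, Memb y u → ¬ PairMemb y x r) :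
    ∃ f : M, (∀ x, (∃ w, PairMemb x w f) ↔ ∃ y, PairMemb x y r ∨ PairMemb y x r) ∧
      ∀ x w, PairMemb x w f → ∀ z, Memb z w ↔ ∃ y, PairMemb y x r ∧ PairMemb y z f := by
  simp [Sentence.Realize, Formula.Realize, betaAxiom, isRelationF, isRegularF, isFunctionF,
      domEqFieldF, isCollapseF, realize_isPairF, realize_memF, realize_pairMemF, realize_eqF, ix,
      Fin.snoc] at hM
  obtain ⟨f, -, h₁, h₂⟩ := hM r hrel fun u x hx => hreg u ⟨x, hx⟩
  exact ⟨f, h₁, h₂⟩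

theorem exists_memb_of_models_infinity (hM : M ⊨ infinity) : ∃ x y : M, Memb x y := by
  simp [Sentence.Realize, Formula.Realize, infinity, realize_memF, realize_eqF, ix,
      Fin.snoc] at hM
  obtain ⟨x, ⟨y, hy, -⟩, -⟩ := hM
  exact ⟨y, x, hy⟩

theorem IsPair.inj {p x y x' y' : M} (h : IsPair p x y) (h' : IsPair p x' y') :
    x = x' ∧ y = y' := by
  obtain ⟨a, b, ha, hb, hp⟩ := h
  obtain ⟨a', b', ha', hb', hp'⟩ := h'
  have hpp : ∀ w, (w = a ∨ w = b) ↔ (w = a' ∨ w = b') := fun w => (hp w).symm.trans (hp' w)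
  have haa : ∀ w, Memb w a ↔ w = x := fun w => (ha w).trans (or_self_iff)
  have haa' : ∀ w, Memb w a' ↔ w = x' := fun w => (ha' w).trans (or_self_iff)
  have hbx := (hb x).2 (Or.inl rfl)
  have hby := (hb y).2 (Or.inr rfl)
  have hbx' := (hb' x').2 (Or.inl rfl)
  have hby' := (hb' y').2 (Or.inr rfl)
  have hax := (haa x).2 rfl
  have hax' := (haa' x').2 rfl
  have hx : x = x' := by
    rcases (hpp a).1 (Or.inl rfl) with h | h
    · exact (haa' x).1 (h ▸ hax)
    · exact ((haa x').1 (h ▸ hbx')).symm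
  subst hx
  refine ⟨rfl, ?_⟩
  have h₁ : ∀ w, Memb w b ∨ w = x ↔ Memb w b' ∨ w = x := by
    intro w
    rcases (hpp b).1 (Or.inr rfl) with h | h <;> rcases (hpp b').2 (Or.inr rfl) with h' | h' <;>
      subst h <;> grind
  have h₂ : ∀ w, (w = y ∨ w = x) ↔ (w = y' ∨ w = x) := fun w => by
    have := h₁ w
    rw [hb w, hb' w] at this
    tauto
  rcases (h₂ y).1 (Or.inl rfl) with h | h
  · exact h
  · rcases (h₂ y').2 (Or.inl rfl) with h' | h'
    · exact h'.symm
    · exact h.trans h'.symm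

/-- A well-founded structure coded by `⟨A, E⟩ ∈ M` is collapsed by a function `f ∈ M`, if `M`
satisfies `Beta`: well-foundedness of `E` implies regularity of `E` in the sense of `M`. -/
theorem exists_collapse (hM : M ⊨ betaAxiom) {c A E : M} (hc : IsStructureCode c A E)
    (hwf : WellFounded (Memb : Coded A E → Coded A E → Prop)) :
    ∃ f : M, ∀ x y : Coded A E, Memb x y →
      (∃ w, PairMemb x.1 w f) ∧ (∃ w, PairMemb y.1 w f) ∧
      ∀ v w, PairMemb x.1 v f → PairMemb y.1 w f → Memb v w := by
  have hE : ∀ x y, PairMemb x y E → Memb x A ∧ Memb y A := by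
    rintro x y ⟨p, hp, hxy⟩
    obtain ⟨x', y', hx', hy', hp'⟩ := hc.2 p hp
    obtain ⟨rfl, rfl⟩ := hxy.inj hp'
    exact ⟨hx', hy'⟩
  obtain ⟨f, h₁, h₂⟩ := exists_collapse_of_models_betaAxiom hM (r := E)
    (fun p hp => by
      obtain ⟨x, y, -, -, h⟩ := hc.2 p hp
      exact ⟨x, y, h⟩)
    (fun u ⟨x, hx⟩ => by
      by_cases hu : ∃ x : Coded A E, Memb x.1 u
      · obtain ⟨x, hx, hmin⟩ := hwf.has_min {x : Coded A E | Memb x.1 u} hu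
        exact ⟨x.1, hx, fun y hy hyx => hmin ⟨y, (hE _ _ hyx).1⟩ hy hyx⟩
      · exact ⟨x, hx, fun y _ hyx => hu ⟨⟨x, (hE _ _ hyx).2⟩, hx⟩⟩)
  refine ⟨f, fun x y hxy => ?_⟩
  have hxy' : PairMemb x.1 y.1 E := hxy
  refine ⟨(h₁ _).2 ⟨_, Or.inl hxy'⟩, (h₁ _).2 ⟨_, Or.inr hxy'⟩, fun v w hv hw => ?_⟩
  exact (h₂ _ _ hw _).2 ⟨_, hxy', hv⟩

theorem PairMemb.rank_lt (hwf : WellFounded (Memb : M → M → Prop)) {x w f : M}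
    (h : PairMemb x w f) : (hwf.apply w).rank < (hwf.apply f).rank := by
  obtain ⟨p, hp, a, b, -, hb, hpab⟩ := h
  have h₁ := (hwf.apply b).rank_lt_of_rel ((hb w).2 (Or.inr rfl))
  have h₂ := (hwf.apply p).rank_lt_of_rel ((hpab b).2 (Or.inr rfl))
  have h₃ := (hwf.apply f).rank_lt_of_rel hp
  exact h₁.trans (h₂.trans h₃)

end Semantics

/-! ### Set theory: heights of `β`-models -/

/-- The countable `β`-models of set theory satisfying axiom `Beta`. -/
structure CountableBetaModel where
  carrier : Type u
  [str : setLang.Structure carrier]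
  [countable : Countable carrier]
  isBetaModel : IsSetBetaModel carrier
  models_beta : carrier ⊨ betaAxiom

attribute [instance] CountableBetaModel.str CountableBetaModel.countable

namespace CountableBetaModel

/-- The height of `M`: the least ordinal greater than the ranks of all elements of `M`. -/
noncomputable def height (M : CountableBetaModel.{u}) : Ordinal.{u} :=
  ⨆ x : M.carrier, Order.succ (M.isBetaModel.1.apply x).rank

/-- The relation `N ∈ M`, that is, `N` is the structure given by an element `⟨A, E⟩` of `M`. The
equation of structures is strict: no isomorphic copies are taken. -/
def Mem (N M : CountableBetaModel.{u}) : Prop :=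
  ∃ (c A E : M.carrier), IsStructureCode c A E ∧
    ∃ (_ : Countable (Coded A E)) (h : IsSetBetaModel (Coded A E))
      (h' : Coded A E ⊨ betaAxiom), N = ⟨Coded A E, h, h'⟩

end CountableBetaModel

theorem infinity_mem_PRS : infinity ∈ PRS :=
  Theory.models_sentence_of_mem PRSAxiom.infinity

theorem IsSetBetaModel.exists_memb {M : Type u} [setLang.Structure M] (h : IsSetBetaModel M) :
    ∃ x y : M, Memb x y :=
  have := h.2
  exists_memb_of_models_infinity (Theory.realize_sentence_of_mem PRS infinity_mem_PRS)

/-- The collapse of `N` has rank below the height of `M`, and collapsing does not lower ranks. -/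
theorem CountableBetaModel.Mem.height_lt {N M : CountableBetaModel.{u}} (h : N.Mem M) :
    N.height < M.height := by
  obtain ⟨c, A, E, hc, _, hβ, hB, rfl⟩ := h
  obtain ⟨f, hf⟩ := exists_collapse M.models_beta hc hβ.1
  have hwf := M.isBetaModel.1
  refine lt_of_le_of_lt (b := (hwf.apply f).rank) (Ordinal.iSup_le fun x => Order.succ_le_of_lt ?_)
    (Order.succ_le_iff.1 (Ordinal.le_iSup (fun x : M.carrier => Order.succ (hwf.apply x).rank) f))
  have key : ∀ (x : Coded A E) w, PairMemb x.1 w f →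
      (hβ.1.apply x).rank ≤ (hwf.apply w).rank := by
    intro x
    induction x using hβ.1.induction with
    | _ x ih =>
      intro w hw
      rw [(hβ.1.apply x).rank_eq]
      refine Ordinal.iSup_le fun y => Order.succ_le_of_lt ?_
      obtain ⟨⟨v, hv⟩, -, h⟩ := hf y.1 x y.2
      exact (ih y.1 y.2 v hv).trans_lt ((hwf.apply w).rank_lt_of_rel (h v w hv hw))
  by_cases hx : ∃ w, PairMemb x.1 w f
  · obtain ⟨w, hw⟩ := hx
    exact (key x w hw).trans_lt (hw.rank_lt hwf)
  · -- an element outside the field has rank `0`, and `f` is not empty by the axiom of infinity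
    have h0 : (hβ.1.apply x).rank = 0 := by
      rw [(hβ.1.apply x).rank_eq, ← nonpos_iff_eq_zero]
      exact Ordinal.iSup_le fun y => absurd (hf y.1 x y.2).2.1 hx
    obtain ⟨y, z, hyz⟩ := hβ.exists_memb
    obtain ⟨w, hw⟩ := (hf y z hyz).1
    have := hw.rank_lt hwf
    change (hβ.1.apply x).rank < _
    rw [h0]
    exact bot_le.trans_lt this

instance countable_setLang_symbols : Countable setLang.Symbols := by
  have : ∀ n, Countable (SetRel n) := fun n =>
    Function.Injective.countable (f := fun _ => 0) (fun a b _ => by cases a; cases b; rfl)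
  have h₁ : ∀ n, Countable (setLang.Functions n) := fun n => inferInstanceAs (Countable Empty)
  have h₂ : ∀ n, Countable (setLang.Relations n) := this
  unfold Language.Symbols
  infer_instance

/-- Elementary substructures of `β`-models are `β`-models, by restriction of well-foundedness. -/
theorem SetTheory.HasBetaModel.exists_countable {T : SetTheory}
    (hT : SetTheory.HasBetaModel.{u} T) :
    ∃ (M : Type u) (_ : setLang.Structure M), Countable M ∧ IsSetBetaModel M ∧ M ⊨ T := by
  obtain ⟨M, _, ⟨hwf, hP⟩, hMT⟩ := hT
  by_cases hc : Countable M
  · exact ⟨M, _, hc, ⟨hwf, hP⟩, hMT⟩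
  · obtain ⟨S, -, hS⟩ := exists_elementarySubstructure_card_eq setLang (M := M) ∅
      Cardinal.aleph0.{u}
      le_rfl (by simp) 
      (by simpa only [Cardinal.lift_aleph0, Cardinal.lift_le_aleph0, Language.card] using
        (Cardinal.mk_le_aleph0 (α := setLang.Symbols)))
      (by
        rw [not_countable_iff, ← Cardinal.aleph0_lt_mk_iff] at hc
        simpa using hc.le)
    have hSc : Countable S := by
      rw [← Cardinal.mk_le_aleph0_iff]
      simpa using hS.le
    refine ⟨S, inferInstance, hSc, ⟨?_, (S.theory_model_iff PRS).2 hP⟩,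
      (S.theory_model_iff T).2 hMT⟩
    refine Subrelation.wf (r := InvImage Memb (Subtype.val : S → M)) ?_ (InvImage.wf _ hwf)
    intro x y hxy
    have h := (S.subtype.toEmbedding.map_rel SetRel.mem ![x, y]).2 hxy
    rwa [show S.subtype.toEmbedding ∘ ![x, y] = ![x.1, y.1] from
      funext fun i => by fin_cases i <;> rfl] at h

/-! ### Set theory: countability of the ranks -/

theorem set_rank_lt_omega_one {T₀ T : SetTheory} (hT₀ : T₀.Extends PRSBeta) (hT : T.Extends T₀)
    (hβ : SetTheory.HasBetaModel.{u} T) : ∃ h : Acc (SetBetaLT.{u} T₀) T, h.rank < ω₁ := by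
  have models_beta : ∀ {S : SetTheory}, S.Extends T₀ → ∀ (M : Type u) [setLang.Structure M],
      IsSetBetaModel M → M ⊨ S → M ⊨ betaAxiom := by
    intro S hS M _ hM hMS
    obtain ⟨x, -⟩ := hM.exists_memb
    have : Nonempty M := ⟨x⟩
    have : M ⊨ T₀ := ⟨fun φ hφ => (hS φ hφ).realize_sentence M⟩
    exact (hT₀ betaAxiom (Or.inr rfl)).realize_sentence M
  obtain ⟨M, _, _, hM, hMT⟩ := hβ.exists_countable
  have hwf : WellFounded CountableBetaModel.Mem.{u} :=
    Subrelation.wf (fun h => h.height_lt) (InvImage.wf CountableBetaModel.height Ordinal.lt_wf)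
  have hcount : ∀ M : CountableBetaModel.{u}, {N | CountableBetaModel.Mem N M}.Countable := by
    intro M
    -- a member of `M` is determined by the pair `(A, E)`
    classical
    refine (Set.countable_range fun p : M.carrier × M.carrier =>
      if h : Countable (Coded p.1 p.2) ∧ IsSetBetaModel (Coded p.1 p.2) ∧
        Coded p.1 p.2 ⊨ betaAxiom then
        @CountableBetaModel.mk (Coded p.1 p.2) _ h.1 h.2.1 h.2.2 else M).mono ?_
    rintro _ ⟨c, A, E, -, h₁, h₂, h₃, rfl⟩
    exact ⟨(A, E), dif_pos ⟨h₁, h₂, h₃⟩⟩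
  have hstep : ∀ (M : CountableBetaModel.{u}) S T, SetBetaLT.{u} T₀ S T → M.carrier ⊨ T →
      ∃ N : CountableBetaModel.{u}, N.Mem M ∧ N.carrier ⊨ S := fun M S T hST hM => by
    obtain ⟨c, A, E, hc, hN, hNS⟩ := hST.2.2 M.carrier M.isBetaModel hM
    have : Countable (Coded A E) := inferInstanceAs (Countable {x : M.carrier // Memb x A})
    exact ⟨⟨Coded A E, hN, models_beta hST.1 _ hN hNS⟩, ⟨c, A, E, hc, this, hN, _, rfl⟩, hNS⟩
  obtain ⟨β, hβ, h⟩ := exists_rank_le_of_acc hcount hstep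
    (hwf.apply ⟨M, hM, models_beta hT M hM hMT⟩)
  obtain ⟨hacc, hle⟩ := h T hMT
  exact ⟨hacc, hle.trans_lt hβ⟩

end BetaRank

/-- For every base theory `T₀` extending `ATR₀` (respectively `PRS + Beta`) and every theory
`T` extending `T₀` that has a `β`-model, `T` lies in the well-founded part of the relation `<_β` on
the theories extending `T₀`, and its rank there is a countable ordinal. -/
theorem mainTheorem1 :
    (∀ T₀ T : BetaRank.L2Theory, T₀.Extends BetaRank.ATR0 → T.Extends T₀ → T.HasBetaModel →
      ∃ h : Acc (BetaRank.L2BetaLT T₀) T, h.rank < ω₁) ∧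
    (∀ T₀ T : BetaRank.SetTheory, T₀.Extends BetaRank.PRSBeta → T.Extends T₀ →
      BetaRank.SetTheory.HasBetaModel.{u} T →
      ∃ h : Acc (BetaRank.SetBetaLT.{u} T₀) T, h.rank < ω₁) :=
  ⟨fun T₀ T _ _ hT => BetaRank.l2_rank_lt_omega_one T₀ T hT,
    fun _ _ hT₀ hT hβ => BetaRank.set_rank_lt_omega_one hT₀ hT hβ⟩
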